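/- Let $p$ be a prime, $k$ an algebraically closed field of characteristic $p$, $G$ a finite group, and $B$ a block algebra of $kG$, i.e. $B=kGb$ where $b=1_B$ is a primitive idempotent of the centre $Z(kG)$. Regard $kG$ and $B$ as $k(G\times G)$-modules, $(x,y)\in G\times G$ acting by $a\mapsto xay^{-1}$; for $H\le G$ put $\Delta H=\{(h,h)\mid h\in H\}$, so that $\Delta G$ acts on $B$ by conjugation. For a $p$-subgroup $Q$ of $G$ let $\mathrm{Br}_Q$ be the map sending $\sum_{x\in G}a_x x$ to $\sum_{x\in C_G(Q)}a_x x$. A $B$-Brauer pair is a pair $(Q,e)$ where $Q$ is a $p$-subgroup of $G$ and $e$ is a block idempotent of $kC_G(Q)$ (a primitive idempotent of its centre) with $e\,\mathrm{Br}_Q(1_B)=e$; put $B_{(Q,e)}=kC_G(Q)eb\subseteq B$. For a $k\Delta G$-module $U$ and $H\le G$ let $\mathrm{tr}^{\Delta G}_{\Delta H}:H^*(\Delta H;U)\to H^*(\Delta G;U)$ be the transfer map. Then: 1. For every $B$-Brauer pair $(Q,e)$, $B_{(Q,e)}$ is a direct summand of $B$ as a $k(C_G(Q)\times C_G(Q))\Delta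 Q$-module. 2. For every $B$-Brauer pair $(Q,e)$, $B_{(Q,e)}$ is isomorphic to $kC_G(Q)e$ as a $k(C_G(Q)\times C_G(Q))\Delta Q$-module. 3. For every $B$-Brauer pair $(Q,e)$, the map $H^*(\Delta Q;B_{(Q,e)})\to H^*(\Delta Q;B)$ induced by the inclusion is split injective as a map of graded $k$-vector spaces; so $H^*(\Delta Q;B_{(Q,e)})$ is identified with a direct summand of $H^*(\Delta Q;B)$. 4. In every degree $n\ge 0$, $$H^n(\Delta G;B)=\sum_{(Q,e)}\mathrm{tr}^{\Delta G}_{\Delta Q}\bigl(H^n(\Delta Q;B_{(Q,e)})\bigr),$$ where $(Q,e)$ runs over any set of representatives of the $G$-conjugacy classes of $B$-Brauer pairs. -/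

import Mathlib

universe u

noncomputable section

namespace BlockCohomology

open CategoryTheory

/-! ### Blocks -/

/-- A block idempotent of a ring: a primitive idempotent of the centre. -/
structure IsBlockIdempotent {R : Type*} [Ring R] (b : R) : Prop where
  isIdempotentElem : IsIdempotentElem b
  mem_center : b ∈ Subring.center R
  ne_zero : b ≠ 0
  primitive : ∀ e f : R, IsIdempotentElem e → e ∈ Subring.center R →
    IsIdempotentElem f → f ∈ Subring.center R → e * f = 0 → e + f = b → e = 0 ∨ f = 0

/-- The group algebra `kG` as a representation of `G × G`: the pair `(x, y)` acts by
`a ↦ x a y⁻¹`. -/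
def biRep (k G : Type*) [CommRing k] [Group G] :
    Representation k (G × G) (MonoidAlgebra k G) where
  toFun x := LinearMap.mulLeft k (MonoidAlgebra.of k G x.1) ∘ₗ
    LinearMap.mulRight k (MonoidAlgebra.of k G x.2⁻¹)
  map_one' := by
    ext a
    simp
  map_mul' x y := by
    refine LinearMap.ext fun a => ?_
    simp only [Prod.fst_mul, Prod.snd_mul, mul_inv_rev, map_mul, LinearMap.comp_apply,
      LinearMap.mulLeft_apply, LinearMap.mulRight_apply, Module.End.mul_apply, mul_assoc]

theorem biRep_apply {k G : Type*} [CommRing k] [Group G] (x : G × G) (a : MonoidAlgebra k G) :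
    biRep k G x a = MonoidAlgebra.of k G x.1 * (a * MonoidAlgebra.of k G x.2⁻¹) :=
  rfl

/-- A block algebra `B` of `kG` is an indecomposable direct factor of the algebra `kG`, that is
`B = kG b` for a block idempotent `b = 1_B` of `kG`. -/
structure Block (k G : Type*) [CommRing k] [Group G] where
  /-- The identity element `1_B` of `B`, as an element of `kG`. -/
  idem : MonoidAlgebra k G
  isBlockIdempotent : IsBlockIdempotent idem

/-- The block algebra `B = kG b` as a `k(G × G)`-submodule of `kG`. -/
def Block.sub {k G : Type*} [CommRing k] [Group G] (B : Block k G) :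
    Subrepresentation (biRep k G) where
  toSubmodule := LinearMap.range (LinearMap.mulRight k B.idem)
  apply_mem_toSubmodule := by
    rintro g _ ⟨a, rfl⟩
    refine ⟨biRep k G g a, ?_⟩
    have h := Subring.mem_center_iff.1 B.isBlockIdempotent.mem_center
    simp only [biRep_apply, LinearMap.mulRight_apply]
    rw [mul_assoc, mul_assoc, h (MonoidAlgebra.of k G g.2⁻¹), mul_assoc]

/-! ### Subgroups of `G × G` -/

/-- The diagonal embedding `g ↦ (g, g)` of `G` into `G × G`. -/
def diag (G : Type*) [Group G] : G →* G × G :=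
  (MonoidHom.id G).prod (MonoidHom.id G)

/-- The centraliser `C_G(Q)`. -/
abbrev cent {G : Type*} [Group G] (Q : Subgroup G) : Subgroup G :=
  Subgroup.centralizer (Q : Set G)

/-- The subgroup `(C_G(Q) × C_G(Q)) ΔQ` of `G × G`, where `ΔQ = {(q, q) | q ∈ Q}`
(the join is the product, because `ΔQ` normalises `C_G(Q) × C_G(Q)`). -/
def centDiag {G : Type*} [Group G] (Q : Subgroup G) : Subgroup (G × G) :=
  (cent Q).prod (cent Q) ⊔ Q.map (diag G)

/-- The embedding `Q → (C_G(Q) × C_G(Q)) ΔQ`, `q ↦ (q, q)`. -/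
def toCentDiag {G : Type*} [Group G] (Q : Subgroup G) : Q →* centDiag Q :=
  ((diag G).comp Q.subtype).codRestrict (centDiag Q) fun q =>
    (le_sup_right : Q.map (diag G) ≤ centDiag Q) (Subgroup.mem_map_of_mem (diag G) q.2)

/-! ### Brauer pairs -/

/-- The inclusion of algebras `kC_G(Q) → kG`. -/
def centIncl (k : Type*) {G : Type*} [CommRing k] [Group G] (Q : Subgroup G) :
    MonoidAlgebra k (cent Q) →ₐ[k] MonoidAlgebra k G :=
  MonoidAlgebra.mapDomainAlgHom k k (cent Q).subtype

/-- The Brauer homomorphism `Br_Q`, under the canonical identification of the Brauer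
construction `(kG)(ΔQ)` with `kC_G(Q)`: it sends `∑_{x ∈ G} a_x x` to `∑_{x ∈ C_G(Q)} a_x x`. -/
def brauerMap {k G : Type*} [CommRing k] [Group G] (Q : Subgroup G) (a : MonoidAlgebra k G) :
    MonoidAlgebra k (cent Q) :=
  MonoidAlgebra.comapDomain (Subtype.val : cent Q → G) Subtype.val_injective a

/-- A `B`-Brauer pair `(Q, e)`: a `p`-subgroup `Q` of `G` and a block idempotent `e` of `kC_G(Q)`
such that `e Br_Q(1_B) = e`. -/
structure BrauerPair (p : ℕ) {k G : Type*} [CommRing k] [Group G] (B : Block k G) where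
  /-- The `p`-subgroup `Q`. -/
  Q : Subgroup G
  isPGroup : IsPGroup p Q
  /-- The block idempotent `e` of `kC_G(Q)`. -/
  e : MonoidAlgebra k (cent Q)
  isBlockIdempotent : IsBlockIdempotent e
  mul_brauerMap : e * brauerMap Q B.idem = e

namespace BrauerPair

variable {p : ℕ} {k G : Type*} [CommRing k] [Group G] {B : Block k G}

/-- `G`-conjugacy of Brauer pairs: `(Q', e') = (gQg⁻¹, geg⁻¹)` for some `g ∈ G`. -/
def IsGConj (P P' : BrauerPair p B) : Prop :=
  ∃ g : G, P'.Q = P.Q.map (MulAut.conj g).toMonoidHom ∧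
    centIncl k P'.Q P'.e =
      MonoidAlgebra.of k G g * centIncl k P.Q P.e * MonoidAlgebra.of k G g⁻¹

end BrauerPair

theorem of_mul_comm_centIncl {k G : Type*} [CommRing k] [Group G] {Q : Subgroup G} {q : G}
    (hq : q ∈ Q) (a : MonoidAlgebra k (cent Q)) :
    MonoidAlgebra.of k G q * centIncl k Q a = centIncl k Q a * MonoidAlgebra.of k G q := by
  induction a using MonoidAlgebra.induction_linear with
  | zero => simp
  | add x y hx hy => simp only [map_add, mul_add, add_mul, hx, hy]
  | single c r =>
    have hc := Subgroup.mem_centralizer_iff.1 c.2 q hq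
    simp [centIncl, MonoidAlgebra.of_apply, MonoidAlgebra.single_mul_single, hc]

/-- For `e` central in `kC_G(Q)` and `z` central in `kG`, the `k`-subspace `kC_G(Q) e z` of `kG`,
as a `k(C_G(Q) × C_G(Q))ΔQ`-submodule of `kG`. -/
def centSub {k G : Type*} [CommRing k] [Group G] (Q : Subgroup G) (e : MonoidAlgebra k (cent Q))
    (he : e ∈ Subring.center (MonoidAlgebra k (cent Q))) (z : MonoidAlgebra k G)
    (hz : z ∈ Subring.center (MonoidAlgebra k G)) :
    Subrepresentation ((biRep k G).comp (centDiag Q).subtype) where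
  toSubmodule :=
    LinearMap.range (LinearMap.mulRight k (centIncl k Q e * z) ∘ₗ (centIncl k Q).toLinearMap)
  apply_mem_toSubmodule := by
    have hz' := Subring.mem_center_iff.1 hz
    have he' := Subring.mem_center_iff.1 he
    set V := LinearMap.range
      (LinearMap.mulRight k (centIncl k Q e * z) ∘ₗ (centIncl k Q).toLinearMap) with hV
    have key : ∀ x ∈ centDiag Q, ∀ v ∈ V, biRep k G x v ∈ V ∧ biRep k G x⁻¹ v ∈ V := by
      have h1 : ∀ x ∈ (cent Q).prod (cent Q), ∀ v ∈ V, biRep k G x v ∈ V := by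
        rintro ⟨c, d⟩ ⟨hc, hd⟩ _ ⟨a, rfl⟩
        have hd' : d⁻¹ ∈ cent Q := inv_mem hd
        refine ⟨MonoidAlgebra.of k (cent Q) ⟨c, hc⟩ * a *
          MonoidAlgebra.of k (cent Q) ⟨d⁻¹, hd'⟩, ?_⟩
        have hcι : centIncl k Q (MonoidAlgebra.of k (cent Q) ⟨c, hc⟩) =
            MonoidAlgebra.of k G c := by simp [centIncl]
        have hdι : centIncl k Q (MonoidAlgebra.of k (cent Q) ⟨d⁻¹, hd'⟩) =
            MonoidAlgebra.of k G d⁻¹ := by simp [centIncl]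
        have hed := congrArg (centIncl k Q) (he' (MonoidAlgebra.of k (cent Q) ⟨d⁻¹, hd'⟩))
        rw [map_mul, map_mul, hdι] at hed
        simp only [LinearMap.comp_apply, LinearMap.mulRight_apply, AlgHom.toLinearMap_apply,
          map_mul, hcι, hdι, biRep_apply]
        rw [mul_assoc (centIncl k Q a), mul_assoc (centIncl k Q e), ← hz' (MonoidAlgebra.of k G d⁻¹),
          ← mul_assoc (centIncl k Q e), ← hed]
        simp only [mul_assoc]
      have h2 : ∀ x ∈ Q.map (diag G), ∀ v ∈ V, biRep k G x v ∈ V := by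
        rintro _ ⟨q, hq, rfl⟩ _ ⟨a, rfl⟩
        refine ⟨a, ?_⟩
        have hq1 := of_mul_comm_centIncl (k := k) hq (a * e)
        have hq2 : MonoidAlgebra.of k G q * MonoidAlgebra.of k G q⁻¹ = 1 := by
          rw [← map_mul, mul_inv_cancel, map_one]
        simp only [LinearMap.comp_apply, LinearMap.mulRight_apply, AlgHom.toLinearMap_apply,
          biRep_apply, diag, MonoidHom.prod_apply, MonoidHom.id_apply]
        rw [← mul_assoc (centIncl k Q a), ← map_mul, mul_assoc (centIncl k Q (a * e)),
          ← hz' (MonoidAlgebra.of k G q⁻¹), ← mul_assoc, hq1, mul_assoc,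
          ← mul_assoc (MonoidAlgebra.of k G q), hq2, one_mul]
      intro x hx
      rw [centDiag, Subgroup.sup_eq_closure] at hx
      induction hx using Subgroup.closure_induction with
      | mem x hx =>
        rcases hx with hx | hx
        · exact fun v hv => ⟨h1 x hx v hv, h1 _ (inv_mem hx) v hv⟩
        · exact fun v hv => ⟨h2 x hx v hv, h2 _ (inv_mem hx) v hv⟩
      | one => intro v hv; simpa using hv
      | mul x y _ _ ihx ihy =>
        intro v hv
        rw [mul_inv_rev, map_mul, map_mul]
        exact ⟨(ihx _ (ihy v hv).1).1, (ihy _ (ihx v hv).2).2⟩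
      | inv x _ ih =>
        intro v hv
        rw [inv_inv]
        exact (ih v hv).symm
    intro g v hv
    exact (key g.1 g.2 v hv).1

/-- The block algebra `B`, as a `k(C_G(Q) × C_G(Q))ΔQ`-submodule of `kG`. -/
def Block.resSub {k G : Type*} [CommRing k] [Group G] (B : Block k G) (Q : Subgroup G) :
    Subrepresentation ((biRep k G).comp (centDiag Q).subtype) where
  toSubmodule := B.sub.toSubmodule
  apply_mem_toSubmodule g _ hv := B.sub.apply_mem_toSubmodule g.1 hv

namespace BrauerPair

variable {p : ℕ} {k G : Type*} [CommRing k] [Group G] {B : Block k G}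

/-- `B_{(Q,e)} = kC_G(Q) e 1_B`, as a `k(C_G(Q) × C_G(Q))ΔQ`-submodule of `kG`. -/
def sub (P : BrauerPair p B) : Subrepresentation ((biRep k G).comp (centDiag P.Q).subtype) :=
  centSub P.Q P.e P.isBlockIdempotent.mem_center B.idem B.isBlockIdempotent.mem_center

/-- `kC_G(Q) e`, as a `k(C_G(Q) × C_G(Q))ΔQ`-submodule of `kG`. -/
def centBlockSub (P : BrauerPair p B) :
    Subrepresentation ((biRep k G).comp (centDiag P.Q).subtype) :=
  centSub P.Q P.e P.isBlockIdempotent.mem_center 1 (one_mem _)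

theorem sub_le (P : BrauerPair p B) : P.sub.toSubmodule ≤ B.sub.toSubmodule := by
  rintro _ ⟨a, rfl⟩
  refine ⟨centIncl k P.Q a * centIncl k P.Q P.e, ?_⟩
  simp [mul_assoc]

end BrauerPair

/-! ### Transfer in group cohomology -/

section Transfer

variable {k G : Type u} [CommRing k] [Group G]

/-- For a subgroup `H` of finite index in `G` and a `kG`-module `U`, the `k`-linear map from
the coinduced module of `Res_H U` to `U` sending an `H`-equivariant function `f : G → U` to
`∑_{x ∈ G/H} x f(x⁻¹)`. -/
def traceLin (H : Subgroup G) [H.FiniteIndex] (U : Rep.{u} k G) :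
    Representation.coindV H.subtype (Rep.res H.subtype U).ρ →ₗ[k] U.V :=
  letI := H.fintypeQuotientOfFiniteIndex
  ∑ x : G ⧸ H, Quotient.liftOn' x
    (fun g => U.ρ g ∘ₗ LinearMap.proj g⁻¹ ∘ₗ Submodule.subtype _) (by
      intro g g' hgg'
      rw [QuotientGroup.leftRel_apply] at hgg'
      refine LinearMap.ext fun f => ?_
      have hf := f.2 ⟨g⁻¹ * g', hgg'⟩ g'⁻¹
      have hf' : f.1 g⁻¹ = U.ρ (g⁻¹ * g') (f.1 g'⁻¹) := by
        simpa using hf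
      simp [hf', ← Module.End.mul_apply, ← map_mul])

/-- The map of `traceLin` as a homomorphism of `kG`-modules `Coind_H^G Res_H U ⟶ U`. -/
def traceHom (H : Subgroup G) [H.FiniteIndex] (U : Rep.{u} k G) :
    Rep.coind H.subtype (Rep.res H.subtype U) ⟶ U :=
  Rep.ofHom (ρ := Representation.coind H.subtype (Rep.res H.subtype U).ρ) (σ := U.ρ)
  { traceLin H U with
    isIntertwining' := by
      intro g
      let _ := H.fintypeQuotientOfFiniteIndex
      refine LinearMap.ext fun f => ?_
      simp only [LinearMap.comp_apply, traceLin, LinearMap.sum_apply, map_sum]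
      refine (Fintype.sum_equiv (MulAction.toPerm g) _ _ fun x => ?_).symm
      induction x using Quotient.inductionOn' with
      | h x =>
      change U.ρ g (U.ρ x (f.1 x⁻¹)) = U.ρ (g * x) (f.1 ((g * x)⁻¹ * g))
      simp }

/-- The transfer map `tr^G_H : H^n(H; Res_H U) → H^n(G; U)` in group cohomology: the inverse of
the Shapiro isomorphism `H^n(G; Coind_H^G Res_H U) ≅ H^n(H; Res_H U)` followed by the map induced
by `Coind_H^G Res_H U ⟶ U`, `f ↦ ∑_{x ∈ G/H} x f(x⁻¹)`. In terms of a projective resolution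
`X` of `k` over `kG`, it is induced by the trace maps
`Hom_{kH}(X, U) → Hom_{kG}(X, U)`, `φ ↦ ∑_{x ∈ G/H} x φ x⁻¹`. -/
def transfer (H : Subgroup G) [H.FiniteIndex] (U : Rep.{u} k G) (n : ℕ) :
    groupCohomology (Rep.res H.subtype U) n ⟶ groupCohomology U n :=
  (groupCohomology.coindIso (Rep.res H.subtype U) n).inv ≫
    groupCohomology.map (MonoidHom.id G) (traceHom H U) n

end Transfer

/-! ### The cohomology of `B` and of `B_{(Q,e)}` -/

section Cohomology

variable {p : ℕ} {k G : Type u} [CommRing k] [Group G] {B : Block k G}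

/-- `B` as a `kΔG`-module, where `G` is identified with `ΔG` via `g ↦ (g, g)`; thus `g ∈ G`
acts by conjugation. -/
def Block.rep (B : Block k G) : Rep.{u} k G :=
  Rep.of (B.sub.toRepresentation.comp (diag G))

/-- `B_{(Q,e)}` as a `kΔQ`-module, where `Q` is identified with `ΔQ` via `q ↦ (q, q)`. -/
def BrauerPair.rep (P : BrauerPair p B) : Rep.{u} k P.Q :=
  Rep.of (P.sub.toRepresentation.comp (toCentDiag P.Q))

/-- The inclusion `B_{(Q,e)} ⟶ B` as a homomorphism of `kΔQ`-modules. -/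
def BrauerPair.incl (P : BrauerPair p B) : P.rep ⟶ Rep.res P.Q.subtype B.rep :=
  Rep.ofHom (ρ := P.sub.toRepresentation.comp (toCentDiag P.Q))
    (σ := (B.sub.toRepresentation.comp (diag G)).comp P.Q.subtype)
  { Submodule.inclusion P.sub_le with
    isIntertwining' := fun _ => rfl }

/-- The map `H^n(ΔQ; B_{(Q,e)}) → H^n(ΔQ; B)` induced by the inclusion. -/
def BrauerPair.cohomIncl (P : BrauerPair p B) (n : ℕ) :
    groupCohomology P.rep n ⟶ groupCohomology (Rep.res P.Q.subtype B.rep) n :=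
  groupCohomology.map (MonoidHom.id P.Q) P.incl n

end Cohomology

end BlockCohomology

end

/-! The first three claims rest on the map `a ↦ Br_Q(a) e 1_B`. Truncation to `C_G(Q)` is a
`kC_G(Q)`-bimodule map invariant under `Q`-conjugation, so this map is `(C_G(Q) ×
C_G(Q))ΔQ`-equivariant. It is the identity on `kC_G(Q) e 1_B` because `e Br_Q(1_B) = e`. It
therefore splits the inclusion into `B`, also in cohomology. For the same reason `Br_Q` inverts
multiplication by `1_B` on `kC_G(Q) e`.

For the last claim, the identity of `B` is written as a sum of relative traces `Tr_Q^G(φ)` of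
`Q`-equivariant maps `φ` into the modules `B_{(Q,e)}`. A Sylow subgroup has invertible index, so the
identity is a trace from it (`mulRight_idem_mem`). A trace from a `p`-subgroup `Q` is then reduced
by induction on `|Q|` (`relTrace_mem_of_isPGroup`). Coordinates outside `C_G(Q)` fall into
nontrivial `Q`-orbits and give traces from proper subgroups. The part on `C_G(Q)` is cut by the
blocks `e` of `kC_G(Q)`: either `e Br_Q(1_B) = e`, giving a Brauer pair, or `e Br_Q(1_B) = 0`, and
then `e 1_B` is supported outside `C_G(Q)`, so the orbit argument applies to it.

In cohomology, the trace of a map factoring through `B_{(Q,e)}` has image in the transfer of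
`H^n(ΔQ; B_{(Q,e)})` (`range_map_le_map_transfer`). This needs the Shapiro isomorphism to be natural
in the coefficients (`coindIso_hom_naturality`). -/

noncomputable section

open CategoryTheory

/-! ### Naturality of `Ext` computed from a projective resolution. -/

namespace ChainComplex

/-- The morphism of cochain complexes `Hom(X, Y) ⟶ Hom(X, Z)` given by postcomposition. -/
def linearYonedaMap {C : Type*} [Category* C] [Abelian C] (A : Type*) [Ring A] [Linear A C]
    (X : ChainComplex C ℕ) {Y Z : C} (f : Y ⟶ Z) :
    X.linearYonedaObj A Y ⟶ X.linearYonedaObj A Z :=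
  (HomologicalComplex.unopFunctor _ _).map
    ((NatTrans.mapHomologicalComplex (NatTrans.rightOp ((linearYoneda A C).map f)) _).app X).op

end ChainComplex

/-- `Ext` is a left derived functor with values in an opposite category; this carries a commutative
square from there back to cohomology. -/
theorem CategoryTheory.unop_comp_iso_naturality {D : Type*} [Category* D] {L L' H H' : Dᵒᵖ}
    {K K' : D} (a : L ≅ H) (a' : L' ≅ H') (o : H ≅ Opposite.op K) (o' : H' ≅ Opposite.op K')
    {m : H ⟶ H'} {h : K' ⟶ K} (w : m ≫ o'.hom = o.hom ≫ h.op) :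
    (a.hom ≫ m ≫ a'.inv).unop ≫ (a.unop.symm ≪≫ o.unop.symm).hom =
      (a'.unop.symm ≪≫ o'.unop.symm).hom ≫ h := by
  apply Quiver.Hom.op_inj
  have w' : o.inv ≫ m = h.op ≫ o'.inv := by
    rw [Iso.inv_comp_eq, ← Category.assoc, ← w, Category.assoc, Iso.hom_inv_id, Category.comp_id]
  simp [reassoc_of% w']

theorem CategoryTheory.ProjectiveResolution.isoExt_hom_naturality {R C : Type*} [Ring R]
    [Category* C] [Abelian C] [Linear R C] [EnoughProjectives C] {X : C}
    (P : ProjectiveResolution X) (n : ℕ) {Y Z : C} (f : Y ⟶ Z) :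
    ((Ext R C n).obj (Opposite.op X)).map f ≫ (P.isoExt (R := R) n Z).hom =
      (P.isoExt (R := R) n Y).hom ≫
        HomologicalComplex.homologyMap (P.complex.linearYonedaMap R f) n := by
  have h1 : ((Ext R C n).obj (Opposite.op X)).map f =
      ((NatTrans.leftDerived (NatTrans.rightOp ((linearYoneda R C).map f)) n).app X).unop := rfl
  rw [h1, ProjectiveResolution.leftDerived_app_eq _ P]
  let oZ : (HomologicalComplex.homologyFunctor _ _ n).obj
      ((((linearYoneda R C).obj Z).rightOp.mapHomologicalComplex _).obj P.complex) ≅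
        Opposite.op ((P.complex.linearYonedaObj R Z).homology n) :=
    HomologicalComplex.homologyOp (P.complex.linearYonedaObj R Z) n
  let oY : (HomologicalComplex.homologyFunctor _ _ n).obj
      ((((linearYoneda R C).obj Y).rightOp.mapHomologicalComplex _).obj P.complex) ≅
        Opposite.op ((P.complex.linearYonedaObj R Y).homology n) :=
    HomologicalComplex.homologyOp (P.complex.linearYonedaObj R Y) n
  have w : (HomologicalComplex.homologyFunctor _ _ n).map ((NatTrans.mapHomologicalComplex
      (NatTrans.rightOp ((linearYoneda R C).map f)) _).app P.complex) ≫ oY.hom =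
      oZ.hom ≫ (HomologicalComplex.homologyMap (P.complex.linearYonedaMap R f) n).op :=
    HomologicalComplex.homologyOp_hom_naturality (P.complex.linearYonedaMap R f) n
  exact unop_comp_iso_naturality (P.isoLeftDerivedObj ((linearYoneda R C).obj Z).rightOp n)
    (P.isoLeftDerivedObj ((linearYoneda R C).obj Y).rightOp n) oZ oY w

/-! ### Naturality of the Shapiro isomorphism in the coefficients. -/

namespace groupCohomology

variable {k G : Type u} [CommRing k] [Group G]

theorem comm_sq_comp {C : Type*} [Category* C] {X X' Y Y' Z Z' : C} {a : X ⟶ X'} {b : Y ⟶ Y'}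
    {c : Z ⟶ Z'} {f : X ⟶ Y} {f' : X' ⟶ Y'} {g : Y ⟶ Z} {g' : Y' ⟶ Z'}
    (h : a ≫ f' = f ≫ b) (h' : b ≫ g' = g ≫ c) : a ≫ f' ≫ g' = (f ≫ g) ≫ c := by
  rw [reassoc_of% h, h', Category.assoc]

theorem comm_sq_inv {C : Type*} [Category* C] {X X' Y Y' : C} {a : X ⟶ X'} {b : Y ⟶ Y'}
    {e : X ≅ Y} {e' : X' ≅ Y'} (h : a ≫ e'.hom = e.hom ≫ b) : b ≫ e'.inv = e.inv ≫ a := by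
  rw [Iso.comp_inv_eq, Category.assoc, h, Iso.inv_hom_id_assoc]

theorem comm_sq_homologyMap {K K' L L' : CochainComplex (ModuleCat.{u} k) ℕ} {a : K ⟶ K'}
    {b : L ⟶ L'} {f : K ⟶ L} {f' : K' ⟶ L'} (h : a ≫ f' = f ≫ b) (n : ℕ) :
    HomologicalComplex.homologyMap a n ≫ HomologicalComplex.homologyMap f' n =
      HomologicalComplex.homologyMap f n ≫ HomologicalComplex.homologyMap b n := by
  rw [← HomologicalComplex.homologyMap_comp, ← HomologicalComplex.homologyMap_comp, h]

theorem inhomogeneousCochainsIso_hom_naturality {A B : Rep.{u} k G} (f : A ⟶ B) :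
    cochainsMap (MonoidHom.id G) f ≫ (inhomogeneousCochainsIso B).hom =
      (inhomogeneousCochainsIso A).hom ≫ (Rep.barComplex k G).linearYonedaMap k f := by
  ext i x
  -- A morphism out of a free module is determined by its values on the basis, where both sides are
  -- `f` applied to the cochain.
  refine (Rep.freeLiftLEquiv k G (Fin i → G) B).injective (funext fun j => ?_)
  have h1 : ∀ (D : Rep.{u} k G) (y : (Fin i → G) → D),
      (((inhomogeneousCochainsIso D).hom.f i).hom y : Rep.free k G (Fin i → G) ⟶ D).hom
        (Finsupp.single j (.single 1 1)) = y j := by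
    intro D y
    exact congrFun ((Rep.freeLiftLEquiv k G (Fin i → G) D).apply_symm_apply y) j
  exact (h1 B _).trans (congrArg f.hom (h1 A x).symm)

theorem linearYonedaObjResProjectiveResolutionIso_hom_naturality {S : Subgroup G}
    (P : ProjectiveResolution (Rep.trivial k G k)) {A B : Rep.{u} k S} (f : A ⟶ B) :
    ChainComplex.linearYonedaMap k
        ((Rep.resFunctor S.subtype).mapProjectiveResolution P).complex f ≫
      (linearYonedaObjResProjectiveResolutionIso P B).hom =
    (linearYonedaObjResProjectiveResolutionIso P A).hom ≫
      P.complex.linearYonedaMap k (Rep.coindMap S.subtype f) := by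
  ext i x
  rfl

theorem groupCohomologyIso_hom_naturality {A B : Rep.{u} k G} (f : A ⟶ B) (n : ℕ)
    (P : ProjectiveResolution (Rep.trivial k G k)) :
    map (MonoidHom.id G) f n ≫ (groupCohomologyIso B n P).hom =
      (groupCohomologyIso A n P).hom ≫
        HomologicalComplex.homologyMap (P.complex.linearYonedaMap k f) n :=
  comm_sq_comp
    (comm_sq_comp
      (comm_sq_homologyMap (inhomogeneousCochainsIso_hom_naturality f) n)
      (comm_sq_inv (e := Rep.barResolution.extIso k G A n) (e' := Rep.barResolution.extIso k G B n)
        ((Rep.barResolution k G).isoExt_hom_naturality n f)))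
    (P.isoExt_hom_naturality n f)

/-- The Shapiro isomorphism is a composite of comparisons: cochains with the bar complex,
coinduction with restriction, and the restricted bar resolution with cochains of `S`. The naturality
squares of these are pasted together. -/
theorem coindIso_hom_naturality {S : Subgroup G} {A B : Rep.{u} k S} (f : A ⟶ B) (n : ℕ) :
    map (MonoidHom.id G) (Rep.coindMap S.subtype f) n ≫ (coindIso B n).hom =
      (coindIso A n).hom ≫ map (MonoidHom.id S) f n :=
  comm_sq_comp
    (comm_sq_homologyMap
      (comm_sq_comp (inhomogeneousCochainsIso_hom_naturality _)
        (comm_sq_inv (linearYonedaObjResProjectiveResolutionIso_hom_naturality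
          (Rep.barResolution k G) f))) n)
    (comm_sq_inv (groupCohomologyIso_hom_naturality f n _))

end groupCohomology

open CategoryTheory

namespace BlockCohomology

/-! ### Transfer and maps that are relative traces. -/

section Transfer

variable {k G : Type u} [CommRing k] [Group G]

theorem traceHom_apply [Finite G] (H : Subgroup G) [inst : Fintype (G ⧸ H)] (U : Rep.{u} k G)
    (f : Representation.coindV H.subtype (Rep.res H.subtype U).ρ) :
    (traceHom H U).hom f = ∑ x : G ⧸ H, U.ρ x.out (f.1 x.out⁻¹) := by
  obtain rfl : inst = H.fintypeQuotientOfFiniteIndex := Subsingleton.elim _ _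
  change traceLin H U f = _
  rw [traceLin, LinearMap.sum_apply]
  refine Finset.sum_congr rfl fun x _ => ?_
  conv_lhs => rw [← Quotient.out_eq' x]
  rfl

theorem map_add_id {A B : Rep.{u} k G} (f g : A ⟶ B) (n : ℕ) :
    groupCohomology.map (MonoidHom.id G) (f + g) n =
      groupCohomology.map (MonoidHom.id G) f n + groupCohomology.map (MonoidHom.id G) g n :=
  HomologicalComplex.homologyMap_add (groupCohomology.cochainsMap (MonoidHom.id G) f)
    (groupCohomology.cochainsMap (MonoidHom.id G) g) n

theorem map_zero_id {A B : Rep.{u} k G} (n : ℕ) :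
    groupCohomology.map (MonoidHom.id G) (0 : A ⟶ B) n = 0 :=
  HomologicalComplex.homologyMap_zero _ _ n

/-- The cohomology map of a relative trace `∑_{x ∈ G/H} x (ι α) x⁻¹` with `ι : V ⟶ Res_H U`
factors through the transfer of the image of `ι`. -/
theorem range_map_le_map_transfer [Finite G] (H : Subgroup G) {U : Rep.{u} k G} {V : Rep.{u} k H}
    (α : Rep.res H.subtype U ⟶ V) (ι : V ⟶ Rep.res H.subtype U) (n : ℕ) :
    LinearMap.range (groupCohomology.map (MonoidHom.id G)
        (Rep.resCoindToHom H.subtype U _ (α ≫ ι) ≫ traceHom H U) n).hom ≤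
      (LinearMap.range (groupCohomology.map (MonoidHom.id H) ι n).hom).map
        (transfer H U n).hom := by
  rintro _ ⟨z, rfl⟩
  set w := groupCohomology.map (MonoidHom.id G) (Rep.resCoindToHom H.subtype U V α) n
  refine ⟨_, ⟨(w ≫ (groupCohomology.coindIso V n).hom).hom z, rfl⟩, ?_⟩
  -- The adjunction is natural in its target, so `ι` can be split off as a coinduced map; Shapiro
  -- naturality then moves it to the cohomology of `H`, in front of the transfer.
  have h1 : Rep.resCoindToHom H.subtype U _ (α ≫ ι) ≫ traceHom H U =
      Rep.resCoindToHom H.subtype U V α ≫ Rep.coindMap H.subtype ι ≫ traceHom H U := rfl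
  have h2 : (groupCohomology.coindIso V n).hom ≫ groupCohomology.map (MonoidHom.id H) ι n ≫
      (groupCohomology.coindIso (Rep.res H.subtype U) n).inv =
      groupCohomology.map (MonoidHom.id G) (Rep.coindMap H.subtype ι) n := by
    rw [← Category.assoc, Iso.comp_inv_eq, groupCohomology.coindIso_hom_naturality]
  have h3 : (w ≫ (groupCohomology.coindIso V n).hom) ≫
      groupCohomology.map (MonoidHom.id H) ι n ≫ transfer H U n =
      groupCohomology.map (MonoidHom.id G)
        (Rep.resCoindToHom H.subtype U _ (α ≫ ι) ≫ traceHom H U) n := by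
    rw [h1, groupCohomology.map_id_comp, groupCohomology.map_id_comp, ← h2, transfer]
    simp only [Category.assoc, w]
  rw [← h3]
  rfl

end Transfer

/-! ### Relative traces: choice of representatives, transitivity, conjugation. -/

section RelativeTrace

variable {k G M : Type*} [CommRing k] [Group G] [AddCommGroup M] [Module k M]

theorem sum_quotient_eq_sum_of_bijective {ι : Type*} [Fintype ι] {H : Subgroup G}
    [Fintype (G ⧸ H)] {f : G → M} (hf : ∀ g, ∀ h ∈ H, f (g * h) = f g) (s : ι → G)
    (hs : Function.Bijective fun i => (s i : G ⧸ H)) : ∑ x : G ⧸ H, f x.out = ∑ i, f (s i) := by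
  refine (Fintype.sum_bijective _ hs _ _ fun i => ?_).symm
  obtain ⟨h, hh⟩ := QuotientGroup.mk_out_eq_mul H (s i)
  rw [hh, hf _ _ h.2]

variable [Finite G]

/-- The relative trace `a ↦ ∑_{x ∈ G/H} x a`, meaningful on the `H`-fixed points. -/
def relTrace (σ : Representation k G M) (H : Subgroup G) : M →ₗ[k] M :=
  letI := Fintype.ofFinite (G ⧸ H)
  ∑ x : G ⧸ H, σ x.out

theorem relTrace_apply (σ : Representation k G M) (H : Subgroup G) [inst : Fintype (G ⧸ H)]
    (a : M) :
    relTrace σ H a = ∑ x : G ⧸ H, σ x.out a := by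
  obtain rfl : inst = Fintype.ofFinite _ := Subsingleton.elim _ _
  rw [relTrace, LinearMap.sum_apply]

/-- Transitivity of the trace: products of representatives of `G/Q` and of `Q/T` represent `G/T`. -/
theorem relTrace_map_subtype (σ : Representation k G M) (Q : Subgroup G) (T : Subgroup Q)
    [Fintype (Q ⧸ T)] {a : M} (ha : ∀ t ∈ T, σ t a = a) :
    relTrace σ Q (∑ q : Q ⧸ T, σ q.out a) = relTrace σ (T.map Q.subtype) a := by
  let _ := Fintype.ofFinite (G ⧸ Q)
  let _ := Fintype.ofFinite (G ⧸ T.map Q.subtype)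
  rw [relTrace_apply, relTrace_apply, sum_quotient_eq_sum_of_bijective (f := fun g => σ g a)
    (s := fun i : (G ⧸ Q) × (Q ⧸ T) => i.1.out * (i.2.out : G)), Fintype.sum_prod_type]
  · simp [map_sum, map_mul]
  · rintro g _ ⟨t, ht, rfl⟩
    simp [map_mul, ha t ht]
  constructor
  · rintro ⟨x, q⟩ ⟨x', q'⟩ h
    obtain ⟨t, ht, h⟩ := QuotientGroup.eq.1 h
    simp only [Subgroup.coe_subtype, mul_inv_rev] at h
    have hx : x = x' := by
      rw [← x.out_eq', ← x'.out_eq']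
      refine QuotientGroup.eq.2 ?_
      have : x.out⁻¹ * x'.out = q.out * t * (q'.out : G)⁻¹ := by rw [h]; group
      rw [this]
      exact (q.out * t * q'.out⁻¹).2
    subst hx
    have hq : q = q' := by
      rw [← q.out_eq', ← q'.out_eq']
      refine QuotientGroup.eq.2 ?_
      have : q.out⁻¹ * q'.out = t := by
        ext
        simp [h]
      rw [this]
      exact ht
    rw [hq]
  · intro y
    induction y using QuotientGroup.induction_on with
    | H y =>
    obtain ⟨h, hh⟩ := QuotientGroup.mk_out_eq_mul Q y
    obtain ⟨t, ht⟩ := QuotientGroup.mk_out_eq_mul T h⁻¹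
    refine ⟨⟨y, (h⁻¹ : Q)⟩, QuotientGroup.eq.2 ⟨t⁻¹, inv_mem t.2, ?_⟩⟩
    simp only [hh, ht]
    simp

/-- If `x` runs over representatives of `G/Q`, then `x g⁻¹` runs over representatives of the cosets
of `gQg⁻¹`. -/
theorem relTrace_map_conj (σ : Representation k G M) (Q : Subgroup G) (g : G) {a : M}
    (ha : ∀ q ∈ Q, σ q a = a) :
    relTrace σ (Q.map (MulAut.conj g).toMonoidHom) (σ g a) = relTrace σ Q a := by
  let _ := Fintype.ofFinite (G ⧸ Q)
  let _ := Fintype.ofFinite (G ⧸ Q.map (MulAut.conj g).toMonoidHom)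
  rw [relTrace_apply, relTrace_apply, sum_quotient_eq_sum_of_bijective
    (f := fun y => σ y (σ g a)) (s := fun x : G ⧸ Q => x.out * g⁻¹)]
  · simp [map_mul]
  · rintro y _ ⟨q, hq, rfl⟩
    have : σ q a = a := ha q hq
    simp [map_mul, this]
  constructor
  · intro x x' h
    obtain ⟨q, hq, h⟩ := QuotientGroup.eq.1 h
    rw [← x.out_eq', ← x'.out_eq']
    refine QuotientGroup.eq.2 ?_
    have : x.out⁻¹ * x'.out = q := by
      have h' : g * q * g⁻¹ = (x.out * g⁻¹)⁻¹ * (x'.out * g⁻¹) := h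
      calc _ = g⁻¹ * ((x.out * g⁻¹)⁻¹ * (x'.out * g⁻¹)) * g := by group
        _ = q := by rw [← h']; group
    rw [this]
    exact hq
  · intro y
    induction y using QuotientGroup.induction_on with
    | H y =>
    obtain ⟨h, hh⟩ := QuotientGroup.mk_out_eq_mul Q (y * g)
    refine ⟨(y * g : G), QuotientGroup.eq.2 ⟨h⁻¹, inv_mem h.2, ?_⟩⟩
    simp [hh, mul_assoc]

theorem relTrace_of_forall_eq (σ : Representation k G M) (H : Subgroup G) {a : M}
    (ha : ∀ g, σ g a = a) : relTrace σ H a = H.index • a := by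
  let _ := Fintype.ofFinite (G ⧸ H)
  simp [relTrace_apply, ha, Subgroup.index, Nat.card_eq_fintype_card]

end RelativeTrace

/-! ### Sums grouped by orbits of a conjugation action. -/

section OrbitSum

theorem sum_mem_of_sum_orbit_mem {Q X M : Type*} [Group Q] [MulAction Q X] [Finite Q] [Fintype X]
    [AddCommMonoid M] (N : AddSubmonoid M) (f : X → M)
    (h : ∀ x : X, ∀ [Fintype (Q ⧸ MulAction.stabilizer Q x)],
      ∑ q : Q ⧸ MulAction.stabilizer Q x, f (q.out • x) ∈ N) : ∑ x, f x ∈ N := by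
  classical
  let _ := Fintype.ofFinite (MulAction.orbitRel.Quotient Q X)
  let _ := fun x : X => Fintype.ofFinite (Q ⧸ MulAction.stabilizer Q x)
  rw [← (MulAction.selfEquivSigmaOrbitsQuotientStabilizer Q X).symm.sum_comp,
    Fintype.sum_sigma]
  refine sum_mem fun ω _ => ?_
  convert h ω.out using 2 with q
  conv_lhs => rw [← Quotient.out_eq' q]
  rfl

/-- The stabilizer of `x` in `Q` under conjugation. -/
abbrev conjStab {G : Type*} [Group G] (Q : Subgroup G) (x : G) : Subgroup Q :=
  (Subgroup.centralizer {x}).subgroupOf Q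

theorem conjStab_ne_top {G : Type*} [Group G] {Q : Subgroup G} {x : G} (hx : x ∉ cent Q) :
    conjStab Q x ≠ ⊤ := by
  intro h
  refine hx (Subgroup.mem_centralizer_iff.2 fun q hq => ?_)
  have h' : (⟨q, hq⟩ : Q) ∈ conjStab Q x := h ▸ Subgroup.mem_top _
  exact (Subgroup.mem_centralizer_singleton_iff.1 (Subgroup.mem_subgroupOf.1 h'))

theorem sum_mem_of_sum_conj_mem {G M : Type*} [Group G] [Fintype G] [AddCommMonoid M]
    (Q : Subgroup G) (N : AddSubmonoid M) (f : G → M) (h0 : ∀ x ∈ cent Q, f x = 0)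
    (h : ∀ x ∉ cent Q, ∀ [Fintype (Q ⧸ conjStab Q x)],
      ∑ q : Q ⧸ conjStab Q x, f (q.out * x * (q.out : G)⁻¹) ∈ N) : ∑ x, f x ∈ N := by
  let inst : MulAction Q G := MulAction.compHom G ((MulAut.conj (G := G)).comp Q.subtype)
  have hs : ∀ x, @MulAction.stabilizer Q G _ inst x = conjStab Q x := by
    intro x
    ext q
    rw [MulAction.mem_stabilizer_iff, Subgroup.mem_subgroupOf,
      Subgroup.mem_centralizer_singleton_iff]
    change (q : G) * x * (q : G)⁻¹ = x ↔ _
    rw [mul_inv_eq_iff_eq_mul]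
  refine @sum_mem_of_sum_orbit_mem Q G M _ inst _ _ _ N f fun x => ?_
  rw [hs x]
  intro _
  by_cases hx : x ∈ cent Q
  · refine sum_mem fun q _ => ?_
    have : q.out • x = x := by
      change (q.out : G) * x * (q.out : G)⁻¹ = x
      rw [Subgroup.mem_centralizer_iff.1 hx _ q.out.2, mul_inv_cancel_right]
    rw [this, h0 x hx]
    exact zero_mem N
  · exact h x hx

end OrbitSum

/-! ### Conjugation, truncation to `C_G(Q)`, and coordinates in `kG`. -/

section GroupAlgebra

variable {k G : Type*} [CommRing k] [Group G]

open MonoidAlgebra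

/-- The conjugation action of `G` on `kG`. -/
abbrev conjRep (k G : Type*) [CommRing k] [Group G] : Representation k G (MonoidAlgebra k G) :=
  (biRep k G).comp (diag G)

theorem conjRep_apply (g : G) (a : MonoidAlgebra k G) :
    conjRep k G g a = of k G g * (a * of k G g⁻¹) :=
  rfl

theorem conjRep_single (g x : G) (r : k) :
    conjRep k G g (single x r) = single (g * x * g⁻¹) r := by
  rw [conjRep_apply, of_apply, of_apply, single_mul_single, single_mul_single, one_mul, mul_one,
    mul_assoc]

theorem conjRep_mul (g : G) (a b : MonoidAlgebra k G) :
    conjRep k G g (a * b) = conjRep k G g a * conjRep k G g b := by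
  have h : of k G g⁻¹ * of k G g = 1 := by rw [← map_mul, inv_mul_cancel, map_one]
  simp only [conjRep_apply, mul_assoc]
  rw [← mul_assoc (of k G g⁻¹) (of k G g), h, one_mul]

theorem conjRep_of_mem_center (g : G) {z : MonoidAlgebra k G}
    (hz : z ∈ Subring.center (MonoidAlgebra k G)) : conjRep k G g z = z := by
  rw [conjRep_apply, ← Subring.mem_center_iff.1 hz, ← mul_assoc, ← map_mul, mul_inv_cancel,
    map_one, one_mul]

theorem conjRep_centIncl {Q : Subgroup G} {q : G} (hq : q ∈ Q) (a : MonoidAlgebra k (cent Q)) :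
    conjRep k G q (centIncl k Q a) = centIncl k Q a := by
  rw [conjRep_apply, ← mul_assoc, of_mul_comm_centIncl hq, mul_assoc, ← map_mul, mul_inv_cancel,
    map_one, mul_one]

theorem centIncl_single (Q : Subgroup G) (c : cent Q) (r : k) :
    centIncl k Q (single c r) = single (c : G) r := by
  simp [centIncl]

/-- The Brauer homomorphism as a linear map on the whole group algebra. -/
def brauerLin (k : Type*) {G : Type*} [CommRing k] [Group G] (Q : Subgroup G) :
    MonoidAlgebra k G →ₗ[k] MonoidAlgebra k (cent Q) where
  toFun := brauerMap Q
  map_add' := comapDomain_add _ _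
  map_smul' r a := by ext; simp [brauerMap]

theorem brauerLin_apply (Q : Subgroup G) (a : MonoidAlgebra k G) :
    brauerLin k Q a = brauerMap Q a :=
  rfl

theorem coeff_brauerLin (Q : Subgroup G) (a : MonoidAlgebra k G) (c : cent Q) :
    (brauerLin k Q a).coeff c = a.coeff c := by
  simp [brauerLin_apply, brauerMap]

theorem brauerLin_single_of_mem {Q : Subgroup G} {x : G} (hx : x ∈ cent Q) (r : k) :
    brauerLin k Q (single x r) = single ⟨x, hx⟩ r :=
  comapDomain_single_map _ Subtype.val_injective (⟨x, hx⟩ : cent Q) r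

theorem brauerLin_single_of_notMem {Q : Subgroup G} {x : G} (hx : x ∉ cent Q) (r : k) :
    brauerLin k Q (single x r) = 0 :=
  comapDomain_single_of_not_mem_range (by simpa using hx) Subtype.val_injective

theorem brauerLin_centIncl (Q : Subgroup G) (a : MonoidAlgebra k (cent Q)) :
    brauerLin k Q (centIncl k Q a) = a := by
  induction a using MonoidAlgebra.induction_linear with
  | zero => simp
  | add x y hx hy => simp only [map_add, hx, hy]
  | single c r => rw [centIncl_single, brauerLin_single_of_mem c.2]

/-- Translation by an element of a subgroup preserves both the subgroup and its complement; hence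
`y` need not be `Q`-fixed. -/
theorem brauerLin_centIncl_mul (Q : Subgroup G) (a : MonoidAlgebra k (cent Q))
    (y : MonoidAlgebra k G) :
    brauerLin k Q (centIncl k Q a * y) = a * brauerLin k Q y := by
  induction a using MonoidAlgebra.induction_linear with
  | zero => simp
  | add u v hu hv => simp only [map_add, add_mul, hu, hv]
  | single c r =>
  induction y using MonoidAlgebra.induction_linear with
  | zero => simp
  | add u v hu hv => simp only [map_add, mul_add, hu, hv]
  | single x s =>
  rw [centIncl_single, single_mul_single]
  by_cases hx : x ∈ cent Q
  · rw [brauerLin_single_of_mem hx, brauerLin_single_of_mem (mul_mem c.2 hx), single_mul_single]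
    rfl
  · rw [brauerLin_single_of_notMem hx, mul_zero, brauerLin_single_of_notMem]
    exact fun h => hx ((Subgroup.mul_mem_cancel_left _ c.2).1 h)

theorem brauerLin_mul_centIncl (Q : Subgroup G) (a : MonoidAlgebra k (cent Q))
    (y : MonoidAlgebra k G) :
    brauerLin k Q (y * centIncl k Q a) = brauerLin k Q y * a := by
  induction a using MonoidAlgebra.induction_linear with
  | zero => simp
  | add u v hu hv => simp only [map_add, mul_add, hu, hv]
  | single c r =>
  induction y using MonoidAlgebra.induction_linear with
  | zero => simp
  | add u v hu hv => simp only [map_add, add_mul, hu, hv]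
  | single x s =>
  rw [centIncl_single, single_mul_single]
  by_cases hx : x ∈ cent Q
  · rw [brauerLin_single_of_mem hx, brauerLin_single_of_mem (mul_mem hx c.2), single_mul_single]
    rfl
  · rw [brauerLin_single_of_notMem hx, zero_mul, brauerLin_single_of_notMem]
    exact fun h => hx ((Subgroup.mul_mem_cancel_right _ c.2).1 h)

/-- Conjugation by `q` fixes `C_G(Q)` pointwise and permutes its complement. -/
theorem brauerLin_conjRep {Q : Subgroup G} {q : G} (hq : q ∈ Q) (a : MonoidAlgebra k G) :
    brauerLin k Q (conjRep k G q a) = brauerLin k Q a := by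
  have hc : ∀ {p y : G}, p ∈ Q → y ∈ cent Q → p * y * p⁻¹ = y := fun hp hy => by
    rw [Subgroup.mem_centralizer_iff.1 hy _ hp, mul_inv_cancel_right]
  induction a using MonoidAlgebra.induction_linear with
  | zero => simp
  | add x y hx hy => simp only [map_add, hx, hy]
  | single x r =>
  rw [conjRep_single]
  by_cases hx : x ∈ cent Q
  · rw [hc hq hx]
  · rw [brauerLin_single_of_notMem hx, brauerLin_single_of_notMem]
    intro h
    have h' := hc (inv_mem hq) h
    refine hx ?_
    have : x = q * x * q⁻¹ := by
      rw [← h']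
      group
    rw [this]
    exact h

/-- The projection of `kG` onto the line spanned by `x`. -/
def coordProj (k : Type*) {G : Type*} [CommRing k] [Group G] (x : G) :
    MonoidAlgebra k G →ₗ[k] MonoidAlgebra k G where
  toFun a := single x (a.coeff x)
  map_add' a b := by simp
  map_smul' r a := by simp

theorem coordProj_apply (x : G) (a : MonoidAlgebra k G) :
    coordProj k x a = single x (a.coeff x) :=
  rfl

theorem sum_coordProj [Fintype G] (a : MonoidAlgebra k G) : ∑ x, coordProj k x a = a := by
  classical
  induction a using MonoidAlgebra.induction_linear with
  | zero => simp
  | add x y hx hy => simp only [map_add, Finset.sum_add_distrib, hx, hy]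
  | single g r =>
    rw [Finset.sum_eq_single g] <;> simp +contextual [coordProj_apply]

theorem conjRep_coordProj (g x : G) (a : MonoidAlgebra k G) :
    conjRep k G g (coordProj k x a) = coordProj k (g * x * g⁻¹) (conjRep k G g a) := by
  classical
  induction a using MonoidAlgebra.induction_linear with
  | zero => simp
  | add x y hx hy => simp only [map_add, hx, hy]
  | single y r =>
    rw [coordProj_apply, conjRep_single, conjRep_single, coordProj_apply]
    simp [Finsupp.single_apply]

theorem coordProj_eq_zero {Q : Subgroup G} {a : MonoidAlgebra k G} (ha : brauerLin k Q a = 0)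
    {x : G} (hx : x ∈ cent Q) : coordProj k x a = 0 := by
  have h := coeff_brauerLin Q a ⟨x, hx⟩
  rw [ha] at h
  rw [coordProj_apply, ← h]
  simp

/-- The coefficients outside `C_G(Q)`: the linear map `a ↦ a - Br_Q(a)`. -/
def offCent (k : Type*) {G : Type*} [CommRing k] [Group G] (Q : Subgroup G) :
    MonoidAlgebra k G →ₗ[k] MonoidAlgebra k G :=
  LinearMap.id - (centIncl k Q).toLinearMap ∘ₗ brauerLin k Q

theorem offCent_apply (Q : Subgroup G) (a : MonoidAlgebra k G) :
    offCent k Q a = a - centIncl k Q (brauerLin k Q a) :=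
  rfl

theorem brauerLin_offCent (Q : Subgroup G) (a : MonoidAlgebra k G) :
    brauerLin k Q (offCent k Q a) = 0 := by
  rw [offCent_apply, map_sub, brauerLin_centIncl, sub_self]

theorem conjRep_offCent {Q : Subgroup G} {q : G} (hq : q ∈ Q) (a : MonoidAlgebra k G) :
    conjRep k G q (offCent k Q a) = offCent k Q (conjRep k G q a) := by
  rw [offCent_apply, map_sub, conjRep_centIncl hq, offCent_apply, brauerLin_conjRep hq]

theorem Block.mem_sub_iff {B : Block k G} {a : MonoidAlgebra k G} :
    a ∈ B.sub.toSubmodule ↔ a * B.idem = a := by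
  constructor
  · rintro ⟨c, rfl⟩
    simp only [LinearMap.mulRight_apply, mul_assoc]
    rw [B.isBlockIdempotent.isIdempotentElem]
  · exact fun h => ⟨a, h⟩

end GroupAlgebra

/-! ### Multiplicativity of `Br_Q` and decomposition into block idempotents. -/

section BrauerHomomorphism

theorem brauerLin_mem_center {k G : Type*} [CommRing k] [Group G] (Q : Subgroup G)
    {z : MonoidAlgebra k G} (hz : z ∈ Subring.center (MonoidAlgebra k G)) :
    brauerLin k Q z ∈ Subring.center (MonoidAlgebra k (cent Q)) := by
  refine Subring.mem_center_iff.2 fun a => ?_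
  rw [← brauerLin_centIncl_mul, Subring.mem_center_iff.1 hz, brauerLin_mul_centIncl]

theorem dvd_card_quotient_of_isPGroup {p : ℕ} [Fact p.Prime] {Q : Type*} [Group Q] [Finite Q]
    (hQ : IsPGroup p Q) {T : Subgroup Q} (hT : T ≠ ⊤) : p ∣ Nat.card (Q ⧸ T) := by
  obtain ⟨n, hn⟩ := hQ.index T
  rw [← Subgroup.index_eq_card, hn]
  refine dvd_pow_self p ?_
  rintro rfl
  exact hT (Subgroup.index_eq_one.1 (by simpa using hn))

/-- `Br_Q` is multiplicative on products of `Q`-fixed points. -/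
theorem brauerLin_mul {p : ℕ} [Fact p.Prime] {k G : Type*} [CommRing k] [CharP k p] [Group G]
    [Finite G] {Q : Subgroup G} (hQ : IsPGroup p Q) {a b : MonoidAlgebra k G}
    (ha : ∀ q ∈ Q, conjRep k G q a = a) (hb : ∀ q ∈ Q, conjRep k G q b = b) :
    brauerLin k Q (a * b) = brauerLin k Q a * brauerLin k Q b := by
  let _ := Fintype.ofFinite G
  rw [← brauerLin_centIncl_mul, ← sub_eq_zero, ← map_sub, ← sub_mul, ← offCent_apply]
  set r := offCent k Q a with hr
  have hr0 : brauerLin k Q r = 0 := brauerLin_offCent Q a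
  have hrq : ∀ q ∈ Q, conjRep k G q r = r := fun q hq => by rw [hr, conjRep_offCent hq, ha q hq]
  rw [← sum_coordProj r, Finset.sum_mul, map_sum, ← AddSubmonoid.mem_bot]
  refine sum_mem_of_sum_conj_mem Q ⊥ _ (fun x hx => ?_) fun x hx _ => ?_
  · rw [coordProj_eq_zero hr0 hx, zero_mul, map_zero]
  · have h : ∀ q : Q ⧸ conjStab Q x,
        brauerLin k Q (coordProj k (q.out * x * (q.out : G)⁻¹) r * b) =
          brauerLin k Q (coordProj k x r * b) := by
      intro q
      have hq := q.out.2
      rw [← brauerLin_conjRep hq (coordProj k x r * b), conjRep_mul, conjRep_coordProj, hrq _ hq,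
        hb _ hq]
    rw [Finset.sum_congr rfl fun q _ => h q, AddSubmonoid.mem_bot, Finset.sum_const,
      Finset.card_univ, ← Nat.card_eq_fintype_card]
    obtain ⟨m, hm⟩ := dvd_card_quotient_of_isPGroup hQ (conjStab_ne_top hx)
    rw [hm, mul_nsmul, ← Nat.cast_smul_eq_nsmul k p, CharP.cast_eq_zero, zero_smul, smul_zero]

/-- Primitivity is applied to `e = ez + e(1 - z)`. -/
theorem IsBlockIdempotent.mul_eq_or_mul_eq_zero {R : Type*} [Ring R] {e z : R}
    (he : IsBlockIdempotent e) (hz : IsIdempotentElem z) (hzc : z ∈ Subring.center R) :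
    e * z = e ∨ e * z = 0 := by
  have hcomm : Commute e z := Subring.mem_center_iff.1 hzc e
  have h1 : IsIdempotentElem (1 - z) := hz.one_sub
  have h1c : 1 - z ∈ Subring.center R := sub_mem (one_mem _) hzc
  have hcomm' : Commute e (1 - z) := Subring.mem_center_iff.1 h1c e
  have h0 : e * z * (e * (1 - z)) = 0 := by
    rw [hcomm'.eq, mul_assoc, ← mul_assoc z, mul_sub, mul_one, hz.eq, sub_self, zero_mul, mul_zero]
  rcases he.primitive (e * z) (e * (1 - z)) (he.isIdempotentElem.mul_of_commute hcomm hz)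
    (mul_mem he.mem_center hzc) (he.isIdempotentElem.mul_of_commute hcomm' h1)
    (mul_mem he.mem_center h1c) h0 (by rw [← mul_add]; simp) with h | h
  · exact Or.inr h
  · left
    rw [mul_sub, mul_one, sub_eq_zero] at h
    exact h.symm

end BrauerHomomorphism

/-- In a finite-dimensional algebra every central idempotent is a sum of block idempotents. -/
theorem mem_closure_isBlockIdempotent (k : Type*) {A : Type*} [Field k] [Ring A] [Algebra k A]
    [FiniteDimensional k A] {f : A} (hf : IsIdempotentElem f) (hfc : f ∈ Subring.center A) :
    f ∈ AddSubmonoid.closure {e : A | IsBlockIdempotent e} := by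
  induction hn : Module.finrank k (LinearMap.range (LinearMap.mulRight k f)) using
    Nat.strong_induction_on generalizing f with
  | _ n ih =>
  by_cases h0 : f = 0
  · rw [h0]
    exact zero_mem _
  by_cases hb : IsBlockIdempotent f
  · exact AddSubmonoid.subset_closure hb
  have : ∃ e e' : A, IsIdempotentElem e ∧ e ∈ Subring.center A ∧ IsIdempotentElem e' ∧
      e' ∈ Subring.center A ∧ e * e' = 0 ∧ e + e' = f ∧ e ≠ 0 ∧ e' ≠ 0 := by
    by_contra! h
    refine hb ⟨hf, hfc, h0, fun e e' he hec he' hec' hmul hadd => ?_⟩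
    by_contra! h'
    exact h'.2 (h e e' he hec he' hec' hmul hadd h'.1)
  obtain ⟨e, e', he, hec, he', hec', hmul, hadd, hne, hne'⟩ := this
  have hmul' : e' * e = 0 := by rw [Subring.mem_center_iff.1 hec, hmul]
  -- `Af` is the direct sum of `Ax` and `Ay`, so `Ax` has smaller dimension when `y ≠ 0`.
  have key : ∀ {x y : A}, IsIdempotentElem x → IsIdempotentElem y → x * y = 0 → y * x = 0 →
      x + y = f → y ≠ 0 → Module.finrank k (LinearMap.range (LinearMap.mulRight k x)) < n := by
    intro x y hx hy hxy hyx hadd hy0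
    rw [← hn]
    refine Submodule.finrank_lt_finrank_of_lt (lt_of_le_of_ne ?_ fun h => hy0 ?_)
    · rintro _ ⟨a, rfl⟩
      refine ⟨a * x, ?_⟩
      simp only [LinearMap.mulRight_apply, ← hadd, mul_assoc, mul_add, hx.eq, hxy, mul_zero, add_zero]
    · have hyf : y ∈ LinearMap.range (LinearMap.mulRight k f) :=
        ⟨y, by simp [← hadd, mul_add, hyx, hy.eq]⟩
      rw [← h] at hyf
      obtain ⟨a, ha⟩ := hyf
      rw [← hy.eq]
      nth_rewrite 1 [← ha]
      rw [LinearMap.mulRight_apply, mul_assoc, hxy, mul_zero]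
  rw [← hadd]
  exact add_mem (ih _ (key he he' hmul hmul' hadd hne') he hec rfl)
    (ih _ (key he' he hmul' hmul (by rw [add_comm, hadd]) hne) he' hec' rfl)

/-! ### Relative traces in `End_k(kG)`. -/

/-- The action of `G` on `End_k(kG)` induced by conjugation on `kG`. -/
abbrev endRep (k G : Type*) [CommRing k] [Group G] :
    Representation k G (MonoidAlgebra k G →ₗ[k] MonoidAlgebra k G) :=
  (conjRep k G).linHom (conjRep k G)

section

variable {k G : Type*} [CommRing k] [Group G]

theorem endRep_apply (g : G) (φ : MonoidAlgebra k G →ₗ[k] MonoidAlgebra k G)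
    (v : MonoidAlgebra k G) :
    endRep k G g φ v = conjRep k G g (φ (conjRep k G g⁻¹ v)) :=
  rfl

theorem conjRep_inv_apply_self (g : G) (v : MonoidAlgebra k G) :
    conjRep k G g (conjRep k G g⁻¹ v) = v := by
  rw [← Module.End.mul_apply, ← map_mul, mul_inv_cancel, map_one, Module.End.one_apply]

theorem apply_conjRep {φ : MonoidAlgebra k G →ₗ[k] MonoidAlgebra k G} {g : G}
    (h : endRep k G g φ = φ) (v : MonoidAlgebra k G) :
    φ (conjRep k G g v) = conjRep k G g (φ v) := by
  have h1 := LinearMap.congr_fun h (conjRep k G g v)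
  rw [endRep_apply] at h1
  rw [← h1, ← Module.End.mul_apply (conjRep k G g⁻¹), ← map_mul, inv_mul_cancel, map_one,
    Module.End.one_apply]

theorem endRep_eq_self {φ : MonoidAlgebra k G →ₗ[k] MonoidAlgebra k G} {g : G}
    (h : ∀ v, conjRep k G g (φ v) = φ (conjRep k G g v)) : endRep k G g φ = φ := by
  refine LinearMap.ext fun v => ?_
  rw [endRep_apply, h, conjRep_inv_apply_self]

theorem conjRep_apply_inv {φ : MonoidAlgebra k G →ₗ[k] MonoidAlgebra k G} {g : G}
    (h : endRep k G g φ = φ) (v : MonoidAlgebra k G) :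
    conjRep k G g (φ (conjRep k G g⁻¹ v)) = φ v :=
  LinearMap.congr_fun h v

theorem Block.mul_idem_comm (B : Block k G) (a : MonoidAlgebra k G) :
    a * B.idem = B.idem * a :=
  Subring.mem_center_iff.1 B.isBlockIdempotent.mem_center a

theorem Block.mul_idem_mem (B : Block k G) (a : MonoidAlgebra k G) :
    a * B.idem ∈ B.sub.toSubmodule :=
  ⟨a, rfl⟩

theorem Block.conjRep_idem (B : Block k G) (g : G) : conjRep k G g B.idem = B.idem :=
  conjRep_of_mem_center g B.isBlockIdempotent.mem_center

/-- A sum of endomorphisms permuted by `Q` along conjugation, vanishing on `C_G(Q)`, has its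
relative trace spanned by relative traces from proper subgroups of `Q`. -/
theorem relTrace_sum_mem [Fintype G] {M : Type*} [AddCommGroup M] [Module k M]
    (σ : Representation k G M) (Q : Subgroup G) (N : AddSubmonoid M) (θ : G → M)
    (h0 : ∀ x ∈ cent Q, θ x = 0) (hθ : ∀ q ∈ Q, ∀ x, σ q (θ x) = θ (q * x * q⁻¹))
    (h : ∀ x, ∀ R < Q, (∀ r ∈ R, σ r (θ x) = θ x) → relTrace σ R (θ x) ∈ N) :
    relTrace σ Q (∑ x, θ x) ∈ N := by
  rw [map_sum]
  refine sum_mem_of_sum_conj_mem Q N _ (fun x hx => by rw [h0 x hx, map_zero]) fun x hx _ => ?_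
  have hfix : ∀ t ∈ conjStab Q x, σ t (θ x) = θ x := by
    intro t ht
    rw [hθ t t.2, Subgroup.mem_centralizer_singleton_iff.1 (Subgroup.mem_subgroupOf.1 ht),
      mul_inv_cancel_right]
  -- The orbit of `x` contributes the trace of `θ x` from its stabilizer to `Q`; by transitivity,
  -- the whole is a trace from the stabilizer to `G`.
  rw [← map_sum, Finset.sum_congr rfl fun q _ => (hθ q.out q.out.2 x).symm,
    relTrace_map_subtype σ Q _ hfix]
  refine h x _ (lt_of_le_of_ne (Subgroup.map_subtype_le _) fun heq => conjStab_ne_top hx ?_) ?_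
  · refine Subgroup.map_injective Q.subtype_injective ?_
    rw [heq, ← MonoidHom.range_eq_map, Subgroup.range_subtype]
  · rintro _ ⟨t, ht, rfl⟩
    exact hfix t ht

end

/-- Conjugate Brauer pairs give the same relative traces. -/
theorem BrauerPair.IsGConj.exists_relTrace_eq {p : ℕ} {k G : Type*} [CommRing k] [Group G]
    [Finite G] {B : Block k G} {P P' : BrauerPair p B}
    (h : P.IsGConj P') {φ : MonoidAlgebra k G →ₗ[k] MonoidAlgebra k G}
    (hφ : ∀ q ∈ P.Q, endRep k G q φ = φ) (hφP : ∀ v, φ v ∈ P.sub.toSubmodule) :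
    ∃ φ' : MonoidAlgebra k G →ₗ[k] MonoidAlgebra k G, (∀ q ∈ P'.Q, endRep k G q φ' = φ') ∧
      (∀ v, φ' v ∈ P'.sub.toSubmodule) ∧
      relTrace (endRep k G) P'.Q φ' = relTrace (endRep k G) P.Q φ := by
  obtain ⟨g, hQ, he⟩ := h
  refine ⟨endRep k G g φ, ?_, fun v => ?_, by rw [hQ, relTrace_map_conj _ _ _ hφ]⟩
  · rw [hQ]
    rintro _ ⟨q, hq, rfl⟩
    change endRep k G (g * q * g⁻¹) _ = _
    rw [← Module.End.mul_apply, ← map_mul, inv_mul_cancel_right, map_mul, Module.End.mul_apply,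
      hφ q hq]
  · rw [endRep_apply]
    obtain ⟨a, ha⟩ := hφP (conjRep k G g⁻¹ v)
    simp only [LinearMap.comp_apply, LinearMap.mulRight_apply, AlgHom.toLinearMap_apply] at ha
    rw [← ha, conjRep_mul, conjRep_mul, B.conjRep_idem]
    have he' : conjRep k G g (centIncl k P.Q P.e) = centIncl k P'.Q P'.e := by
      rw [he, conjRep_apply, mul_assoc]
    have ha' : ∃ a', centIncl k P'.Q a' = conjRep k G g (centIncl k P.Q a) := by
      clear ha
      induction a using MonoidAlgebra.induction_linear with
      | zero => exact ⟨0, by simp⟩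
      | add x y hx hy =>
        obtain ⟨x', hx⟩ := hx
        obtain ⟨y', hy⟩ := hy
        exact ⟨x' + y', by simp only [map_add, hx, hy]⟩
      | single c r =>
        have hc : g * c * g⁻¹ ∈ cent P'.Q := by
          rw [hQ]
          refine Subgroup.mem_centralizer_iff.2 ?_
          rintro _ ⟨q, hq, rfl⟩
          have := Subgroup.mem_centralizer_iff.1 c.2 q hq
          change g * q * g⁻¹ * (g * c * g⁻¹) = g * c * g⁻¹ * (g * q * g⁻¹)
          calc _ = g * (q * c) * g⁻¹ := by group
            _ = _ := by rw [this]; group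
        exact ⟨.single ⟨_, hc⟩ r, by rw [centIncl_single, centIncl_single, conjRep_single]⟩
    obtain ⟨a', ha'⟩ := ha'
    refine ⟨a', ?_⟩
    simp only [LinearMap.comp_apply, LinearMap.mulRight_apply, AlgHom.toLinearMap_apply]
    rw [ha', he']

/-! ### The identity of `B` as a sum of traces from Brauer pairs. -/

section Field

variable {p : ℕ} [Fact p.Prime] {k : Type*} [Field k] [CharP k p] {G : Type*} [Group G] [Finite G]

/-- If relative traces of the equivariant maps into the `B_{(Q,e)}` lie in `N`, then so do the
relative traces of all equivariant maps into `B` from `p`-subgroups. -/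
theorem relTrace_mem_of_isPGroup (B : Block k G)
    (N : AddSubmonoid (MonoidAlgebra k G →ₗ[k] MonoidAlgebra k G))
    (hN : ∀ (P : BrauerPair p B) (φ : MonoidAlgebra k G →ₗ[k] MonoidAlgebra k G),
      (∀ q ∈ P.Q, endRep k G q φ = φ) → (∀ v, φ v ∈ P.sub.toSubmodule) →
        relTrace (endRep k G) P.Q φ ∈ N)
    (Q : Subgroup G) (hQ : IsPGroup p Q) (φ : MonoidAlgebra k G →ₗ[k] MonoidAlgebra k G)
    (hφ : ∀ q ∈ Q, endRep k G q φ = φ) (hφB : ∀ v, φ v ∈ B.sub.toSubmodule) :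
    relTrace (endRep k G) Q φ ∈ N := by
  let _ := Fintype.ofFinite G
  induction hn : Nat.card Q using Nat.strong_induction_on generalizing Q φ with
  | _ n ih =>
  have hlt : ∀ R < Q, ∀ ψ : MonoidAlgebra k G →ₗ[k] MonoidAlgebra k G,
      (∀ r ∈ R, endRep k G r ψ = ψ) → (∀ v, ψ v ∈ B.sub.toSubmodule) →
        relTrace (endRep k G) R ψ ∈ N := fun R hR ψ h1 h2 =>
    ih _ (hn ▸ Set.ncard_lt_ncard hR) R (hQ.to_le hR.le) ψ h1 h2 rfl
  have hbb : B.idem * B.idem = B.idem := B.isBlockIdempotent.isIdempotentElem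
  let mulB : MonoidAlgebra k G →ₗ[k] MonoidAlgebra k G := LinearMap.mulRight k B.idem
  -- `base` is `Br_Q ∘ φ`. It is `Q`-invariant with `Q`-fixed values, so conjugating `v ↦ base v *
  -- c` by `Q` affects only the factor `c`.
  let base : MonoidAlgebra k G →ₗ[k] MonoidAlgebra k G :=
    (centIncl k Q).toLinearMap ∘ₗ brauerLin k Q ∘ₗ φ
  have hbase : ∀ q ∈ Q, ∀ v, base (conjRep k G q v) = base v := by
    intro q hq v
    simp only [base, LinearMap.comp_apply]
    rw [apply_conjRep (hφ q hq), brauerLin_conjRep hq]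
  have hbase' : ∀ q ∈ Q, ∀ v, conjRep k G q (base v) = base v := fun q hq v =>
    conjRep_centIncl hq _
  have hcent : ∀ z ∈ AddSubmonoid.closure {e : MonoidAlgebra k (cent Q) | IsBlockIdempotent e},
      relTrace (endRep k G) Q (LinearMap.mulRight k (centIncl k Q z * B.idem) ∘ₗ base) ∈ N := by
    intro z hz
    induction hz using AddSubmonoid.closure_induction with
    | zero =>
      rw [map_zero, zero_mul, LinearMap.mulRight_zero_eq_zero, LinearMap.zero_comp, map_zero]
      exact zero_mem N
    | add x y _ _ hx hy =>
      have : LinearMap.mulRight k (centIncl k Q (x + y) * B.idem) ∘ₗ base =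
          LinearMap.mulRight k (centIncl k Q x * B.idem) ∘ₗ base +
          LinearMap.mulRight k (centIncl k Q y * B.idem) ∘ₗ base :=
        LinearMap.ext fun v => by simp [add_mul, mul_add, mul_assoc]
      rw [this, map_add]
      exact add_mem hx hy
    | mem e he =>
      have hfix : ∀ q ∈ Q, conjRep k G q (centIncl k Q e * B.idem) = centIncl k Q e * B.idem :=
        fun q hq => by rw [conjRep_mul, conjRep_centIncl hq, B.conjRep_idem]
      have hbr : IsIdempotentElem (brauerLin k Q B.idem) := by
        rw [IsIdempotentElem, ← brauerLin_mul hQ (fun q _ => B.conjRep_idem q)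
          (fun q _ => B.conjRep_idem q), hbb]
      rcases he.mul_eq_or_mul_eq_zero hbr
        (brauerLin_mem_center Q B.isBlockIdempotent.mem_center) with h | h
      · refine hN ⟨Q, hQ, e, he, h⟩ _ (fun q hq => endRep_eq_self fun v => ?_) fun v => ?_
        · simp only [LinearMap.comp_apply, LinearMap.mulRight_apply]
          rw [conjRep_mul, hfix q hq, hbase' q hq, hbase q hq]
        · exact ⟨brauerLin k Q (φ v), rfl⟩
      · set c := centIncl k Q e * B.idem with hc
        have hc0 : brauerLin k Q c = 0 := by rw [hc, brauerLin_centIncl_mul, h]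
        -- A single coordinate of `c` need not lie in `B`. The extra factor `1_B` brings each term
        -- back into `B` and leaves the sum unchanged, as `c * 1_B = c`.
        let θ : G → MonoidAlgebra k G →ₗ[k] MonoidAlgebra k G := fun x =>
          LinearMap.mulRight k (coordProj k x c * B.idem) ∘ₗ base
        have hsum : LinearMap.mulRight k c ∘ₗ base = ∑ x, θ x := by
          refine LinearMap.ext fun v => ?_
          simp only [θ, LinearMap.sum_apply, LinearMap.comp_apply, LinearMap.mulRight_apply]
          rw [← Finset.mul_sum, ← Finset.sum_mul, sum_coordProj, hc, mul_assoc (centIncl k Q e),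
            hbb]
        rw [hsum]
        refine relTrace_sum_mem _ Q N θ (fun x hx => ?_) (fun q hq x => ?_) fun x R hR hR' =>
          hlt R hR _ hR' fun v => ?_
        · simp only [θ]
          rw [coordProj_eq_zero hc0 hx, zero_mul, LinearMap.mulRight_zero_eq_zero,
            LinearMap.zero_comp]
        · refine LinearMap.ext fun v => ?_
          rw [endRep_apply]
          simp only [θ, LinearMap.comp_apply, LinearMap.mulRight_apply]
          rw [conjRep_mul, conjRep_mul, conjRep_coordProj, hfix q hq, B.conjRep_idem,
            hbase' q hq, hbase _ (inv_mem hq)]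
        · simp only [θ, LinearMap.comp_apply, LinearMap.mulRight_apply, ← mul_assoc]
          exact B.mul_idem_mem _
  -- The coordinates of `φ` off `C_G(Q)`, plus its part on `C_G(Q)`, each multiplied by `1_B` to
  -- stay in `B`. The second term is then decomposed along `1 = ∑ e`.
  have hsplit : φ = ∑ x, mulB ∘ₗ coordProj k x ∘ₗ offCent k Q ∘ₗ φ +
      LinearMap.mulRight k (centIncl k Q 1 * B.idem) ∘ₗ base := by
    refine LinearMap.ext fun v => ?_
    simp only [mulB, base, LinearMap.add_apply, LinearMap.sum_apply, LinearMap.comp_apply,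
      LinearMap.mulRight_apply, map_one, one_mul]
    rw [← Finset.sum_mul, sum_coordProj, ← add_mul, offCent_apply, AlgHom.toLinearMap_apply,
      sub_add_cancel, Block.mem_sub_iff.1 (hφB v)]
  rw [hsplit, map_add]
  refine add_mem (relTrace_sum_mem _ Q N _ (fun x hx => ?_) (fun q hq x => ?_)
    fun x R hR hR' => hlt R hR _ hR' fun v => B.mul_idem_mem _) (hcent 1 ?_)
  · refine LinearMap.ext fun v => ?_
    simp only [mulB, LinearMap.comp_apply]
    rw [coordProj_eq_zero (brauerLin_offCent Q _) hx, map_zero]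
    rfl
  · refine LinearMap.ext fun v => ?_
    rw [endRep_apply]
    simp only [mulB, LinearMap.comp_apply, LinearMap.mulRight_apply]
    rw [conjRep_mul, B.conjRep_idem, conjRep_coordProj, conjRep_offCent hq,
      conjRep_apply_inv (hφ q hq)]
  · exact mem_closure_isBlockIdempotent k IsIdempotentElem.one (one_mem _)

/-- The projection onto `B` is `G`-equivariant, so it equals the trace from a Sylow subgroup `S` of
its multiple by `[G : S]⁻¹`. -/
theorem mulRight_idem_mem (B : Block k G)
    (N : AddSubmonoid (MonoidAlgebra k G →ₗ[k] MonoidAlgebra k G))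
    (hN : ∀ (P : BrauerPair p B) (φ : MonoidAlgebra k G →ₗ[k] MonoidAlgebra k G),
      (∀ q ∈ P.Q, endRep k G q φ = φ) → (∀ v, φ v ∈ P.sub.toSubmodule) →
        relTrace (endRep k G) P.Q φ ∈ N) :
    LinearMap.mulRight k B.idem ∈ N := by
  have hb : ∀ g, endRep k G g (LinearMap.mulRight k B.idem) = LinearMap.mulRight k B.idem :=
    fun g => endRep_eq_self fun v => by
      rw [LinearMap.mulRight_apply, conjRep_mul, B.conjRep_idem, LinearMap.mulRight_apply]
  obtain ⟨S⟩ : Nonempty (Sylow p G) := inferInstance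
  have hS : ((S : Subgroup G).index : k) ≠ 0 := by
    rw [Ne, CharP.cast_eq_zero_iff k p]
    exact S.not_dvd_index
  have h := relTrace_mem_of_isPGroup B N hN S S.isPGroup'
    (((S : Subgroup G).index : k)⁻¹ • LinearMap.mulRight k B.idem)
    (fun q _ => by rw [map_smul, hb q]) fun v => Submodule.smul_mem _ _ ⟨v, rfl⟩
  rwa [map_smul, relTrace_of_forall_eq _ _ hb, ← Nat.cast_smul_eq_nsmul k, smul_smul,
    inv_mul_cancel₀ hS, one_smul] at h

end Field

open CategoryTheory MonoidAlgebra

/-! ### The retraction onto `B_{(Q,e)}` and the comparison with `kC_G(Q) e`. -/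

namespace BrauerPair

variable {p : ℕ} {k G : Type*} [CommRing k] [Group G] {B : Block k G} (P : BrauerPair p B)

/-- The retraction `a ↦ Br_Q(a) e 1_B` of `kG` onto `B_{(Q,e)}`. -/
def retraction : MonoidAlgebra k G →ₗ[k] MonoidAlgebra k G :=
  LinearMap.mulRight k (centIncl k P.Q P.e * B.idem) ∘ₗ (centIncl k P.Q).toLinearMap ∘ₗ
    brauerLin k P.Q

theorem retraction_apply (a : MonoidAlgebra k G) :
    P.retraction a = centIncl k P.Q (brauerLin k P.Q a) * (centIncl k P.Q P.e * B.idem) :=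
  rfl

theorem retraction_mem (a : MonoidAlgebra k G) : P.retraction a ∈ P.sub.toSubmodule :=
  ⟨brauerLin k P.Q a, rfl⟩

/-- The condition `e Br_Q(1_B) = e` enters here: `Br_Q` recovers `a e` from `a e 1_B`. -/
theorem brauerLin_mul_e_mul_idem (a : MonoidAlgebra k (cent P.Q)) :
    brauerLin k P.Q (centIncl k P.Q a * (centIncl k P.Q P.e * B.idem)) = a * P.e := by
  rw [brauerLin_centIncl_mul, brauerLin_centIncl_mul, brauerLin_apply, P.mul_brauerMap]

theorem retraction_of_mem {a : MonoidAlgebra k G} (ha : a ∈ P.sub.toSubmodule) :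
    P.retraction a = a := by
  obtain ⟨c, rfl⟩ := ha
  simp only [LinearMap.comp_apply, LinearMap.mulRight_apply, AlgHom.toLinearMap_apply]
  rw [retraction_apply, brauerLin_mul_e_mul_idem, map_mul, mul_assoc,
    ← mul_assoc (centIncl k P.Q P.e), ← map_mul, P.isBlockIdempotent.isIdempotentElem]

theorem brauerLin_biRep {Q : Subgroup G} {c d : G} (hc : c ∈ cent Q) (hd : d ∈ cent Q)
    (a : MonoidAlgebra k G) :
    brauerLin k Q (biRep k G (c, d) a) =
      of k (cent Q) ⟨c, hc⟩ * (brauerLin k Q a * of k (cent Q) ⟨d⁻¹, inv_mem hd⟩) := by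
  have h : ∀ (x : G) (hx : x ∈ cent Q), of k G x = centIncl k Q (of k (cent Q) ⟨x, hx⟩) :=
    fun x hx => (centIncl_single Q ⟨x, hx⟩ 1).symm
  rw [biRep_apply, h c hc, h d⁻¹ (inv_mem hd), brauerLin_centIncl_mul, brauerLin_mul_centIncl]

/-- It suffices to treat generators. On `C_G(Q) × C_G(Q)` it follows from `Br_Q` being a bimodule
map, `e` central in `kC_G(Q)` and `1_B` central in `kG`; on `ΔQ`, from both idempotents and the
values of `Br_Q` being `Q`-fixed. -/
theorem retraction_biRep (x : G × G) (hx : x ∈ centDiag P.Q) (a : MonoidAlgebra k G) :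
    P.retraction (biRep k G x a) = biRep k G x (P.retraction a) := by
  have hinv : ∀ y : G × G, (∀ v, P.retraction (biRep k G y v) = biRep k G y (P.retraction v)) →
      ∀ v, P.retraction (biRep k G y⁻¹ v) = biRep k G y⁻¹ (P.retraction v) := by
    intro y hy v
    have h1 : ∀ w, biRep k G y (biRep k G y⁻¹ w) = w := fun w => by
      rw [← Module.End.mul_apply, ← map_mul, mul_inv_cancel, map_one, Module.End.one_apply]
    have h2 : ∀ w, biRep k G y⁻¹ (biRep k G y w) = w := fun w => by
      rw [← Module.End.mul_apply, ← map_mul, inv_mul_cancel, map_one, Module.End.one_apply]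
    rw [← h2 (P.retraction (biRep k G y⁻¹ v)), ← hy, h1]
  rw [centDiag, Subgroup.sup_eq_closure] at hx
  induction hx using Subgroup.closure_induction generalizing a with
  | mem x hx =>
    rcases hx with hx | hx
    · obtain ⟨c, d⟩ := x
      obtain ⟨hc, hd⟩ := hx
      change c ∈ cent P.Q at hc
      change d ∈ cent P.Q at hd
      have hed := congrArg (centIncl k P.Q) (Subring.mem_center_iff.1 P.isBlockIdempotent.mem_center
        (of k (cent P.Q) ⟨d⁻¹, inv_mem hd⟩))
      have h : ∀ (x : G) (hx : x ∈ cent P.Q),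
          centIncl k P.Q (of k (cent P.Q) ⟨x, hx⟩) = of k G x :=
        fun x hx => centIncl_single P.Q ⟨x, hx⟩ 1
      rw [map_mul, map_mul, h] at hed
      rw [retraction_apply, brauerLin_biRep hc hd, map_mul, map_mul, h, h, biRep_apply,
        retraction_apply]
      simp only [mul_assoc]
      rw [← B.mul_idem_comm (of k G d⁻¹), ← mul_assoc (of k G d⁻¹) (centIncl k P.Q P.e), hed,
        mul_assoc]
    · obtain ⟨q, hq, rfl⟩ := hx
      change P.retraction (conjRep k G q a) = conjRep k G q (P.retraction a)
      rw [retraction_apply, brauerLin_conjRep hq, retraction_apply, conjRep_mul, conjRep_mul,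
        conjRep_centIncl hq, conjRep_centIncl hq, B.conjRep_idem]
  | one => simp
  | mul x y _ _ ihx ihy => rw [map_mul, Module.End.mul_apply, ihx, ihy, Module.End.mul_apply]
  | inv x _ ih => exact hinv x ih a

theorem exists_isCompl :
    ∃ C : Subrepresentation ((biRep k G).comp (centDiag P.Q).subtype),
      P.sub ⊓ C = ⊥ ∧ P.sub ⊔ C = B.resSub P.Q := by
  -- The complement is the kernel of the retraction on `B`.
  refine ⟨⟨B.sub.toSubmodule ⊓ LinearMap.ker P.retraction, fun g v hv => ⟨?_, ?_⟩⟩, ?_, ?_⟩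
  · exact B.sub.apply_mem_toSubmodule g.1 hv.1
  · have h := P.retraction_biRep g.1 g.2 v
    rw [LinearMap.mem_ker.1 hv.2, map_zero] at h
    exact h
  · refine Subrepresentation.toSubmodule_injective (eq_bot_iff.2 ?_)
    rintro v ⟨h1, -, h2⟩
    rw [← P.retraction_of_mem h1]
    exact h2
  · refine Subrepresentation.toSubmodule_injective (le_antisymm (sup_le P.sub_le inf_le_left) ?_)
    intro v hv
    have h := P.retraction_mem v
    refine Submodule.mem_sup.2 ⟨_, h, v - P.retraction v,
      ⟨sub_mem hv (P.sub_le h), ?_⟩, add_sub_cancel _ _⟩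
    change P.retraction (v - P.retraction v) = 0
    rw [map_sub, P.retraction_of_mem h, sub_self]

/-- Multiplication by `1_B` as a map `kC_G(Q) e → kC_G(Q) e 1_B`. -/
def mulIdem : P.centBlockSub.toSubmodule →ₗ[k] P.sub.toSubmodule :=
  (LinearMap.mulRight k B.idem).restrict <| by
    rintro _ ⟨a, rfl⟩
    refine ⟨a, ?_⟩
    simp [mul_assoc]

theorem coe_mulIdem (v : P.centBlockSub.toSubmodule) : (P.mulIdem v).1 = v.1 * B.idem :=
  rfl

theorem mulIdem_bijective : Function.Bijective P.mulIdem := by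
  constructor
  · rw [injective_iff_map_eq_zero]
    rintro ⟨_, a, rfl⟩ h
    have h' := congrArg (fun v : P.sub.toSubmodule => brauerLin k P.Q v.1) h
    simp only [coe_mulIdem, LinearMap.comp_apply, LinearMap.mulRight_apply,
      AlgHom.toLinearMap_apply, mul_one, mul_assoc] at h'
    rw [brauerLin_mul_e_mul_idem] at h'
    refine Subtype.ext ?_
    simp only [LinearMap.comp_apply, LinearMap.mulRight_apply, AlgHom.toLinearMap_apply, mul_one]
    rw [← map_mul, h']
    simp
  · rintro ⟨_, a, rfl⟩
    refine ⟨⟨_, a, rfl⟩, Subtype.ext ?_⟩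
    simp [coe_mulIdem, mul_assoc]

theorem nonempty_equiv_centBlockSub :
    Nonempty (P.sub.toRepresentation.Equiv P.centBlockSub.toRepresentation) := by
  refine ⟨(Representation.Equiv.mk (LinearEquiv.ofBijective _ P.mulIdem_bijective)
    fun g => ?_).symm⟩
  refine LinearMap.ext fun v => Subtype.ext ?_
  change biRep k G g.1 v.1 * B.idem = biRep k G g.1 (v.1 * B.idem)
  rw [biRep_apply, biRep_apply, mul_assoc, mul_assoc, mul_assoc, B.mul_idem_comm (of k G g.1.2⁻¹)]

end BrauerPair

/-! ### Passage to cohomology. -/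

section Cohomology

variable {p : ℕ} {k G : Type u} [CommRing k] [Group G] {B : Block k G}

/-- The retraction of `B` onto `B_{(Q,e)}` as a homomorphism of `kΔQ`-modules. -/
def BrauerPair.retractionHom (P : BrauerPair p B) : Rep.res P.Q.subtype B.rep ⟶ P.rep :=
  Rep.ofHom (ρ := (B.sub.toRepresentation.comp (diag G)).comp P.Q.subtype)
    (σ := P.sub.toRepresentation.comp (toCentDiag P.Q))
  { P.retraction.restrict (p := B.sub.toSubmodule) (q := P.sub.toSubmodule)
      fun v _ => P.retraction_mem v with
    isIntertwining' := fun q => LinearMap.ext fun v => Subtype.ext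
      (P.retraction_biRep (diag G q) (toCentDiag P.Q q).2 v.1) }

theorem BrauerPair.incl_comp_retractionHom (P : BrauerPair p B) :
    P.incl ≫ P.retractionHom = 𝟙 P.rep := by
  ext v
  exact Subtype.ext (P.retraction_of_mem v.2)

theorem BrauerPair.exists_retraction_cohomIncl (P : BrauerPair p B) (n : ℕ) :
    ∃ r : groupCohomology (Rep.res P.Q.subtype B.rep) n →ₗ[k] groupCohomology P.rep n,
      r ∘ₗ (P.cohomIncl n).hom = LinearMap.id := by
  refine ⟨(groupCohomology.map (MonoidHom.id P.Q) P.retractionHom n).hom, ?_⟩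
  have h : P.cohomIncl n ≫ groupCohomology.map (MonoidHom.id P.Q) P.retractionHom n = 𝟙 _ := by
    rw [BrauerPair.cohomIncl, ← groupCohomology.map_id_comp, P.incl_comp_retractionHom,
      groupCohomology.map_id]
  rw [← ModuleCat.hom_comp, h]
  rfl

/-- A relative trace of an equivariant map into `B_{(Q,e)}` induces an endomorphism of `B` whose
image in cohomology lies in the transfer of the cohomology of `B_{(Q,e)}`. -/
theorem BrauerPair.exists_hom_of_relTrace [Finite G] (P : BrauerPair p B)
    {φ : MonoidAlgebra k G →ₗ[k] MonoidAlgebra k G}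
    (hφ : ∀ q ∈ P.Q, endRep k G q φ = φ) (hφP : ∀ v, φ v ∈ P.sub.toSubmodule) (n : ℕ) :
    ∃ F : B.rep ⟶ B.rep,
      (∀ v : B.sub.toSubmodule,
        (F.hom v : B.sub.toSubmodule).1 = relTrace (endRep k G) P.Q φ v.1) ∧
      LinearMap.range (groupCohomology.map (A := B.rep) (B := B.rep) (MonoidHom.id G) F n).hom ≤
        (LinearMap.range (P.cohomIncl n).hom).map (transfer P.Q B.rep n).hom := by
  let _ := Fintype.ofFinite (G ⧸ P.Q)
  let α : Rep.res P.Q.subtype B.rep ⟶ P.rep :=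
    Rep.ofHom (ρ := (B.sub.toRepresentation.comp (diag G)).comp P.Q.subtype)
      (σ := P.sub.toRepresentation.comp (toCentDiag P.Q))
    { φ.restrict (p := B.sub.toSubmodule) (q := P.sub.toSubmodule) fun v _ => hφP v with
      isIntertwining' := fun q => LinearMap.ext fun v => Subtype.ext
        (apply_conjRep (hφ q q.2) v.1) }
  refine ⟨Rep.resCoindToHom P.Q.subtype B.rep _ (α ≫ P.incl) ≫ traceHom P.Q B.rep, fun v => ?_,
    range_map_le_map_transfer P.Q α P.incl n⟩
  have h := traceHom_apply P.Q B.rep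
    ((Rep.resCoindToHom P.Q.subtype B.rep _ (α ≫ P.incl)).hom v)
  refine (congrArg (fun w : B.sub.toSubmodule => w.1) h).trans ?_
  rw [relTrace_apply, LinearMap.sum_apply]
  refine (map_sum B.sub.toSubmodule.subtype _ _).trans ?_
  rfl

theorem iSup_map_transfer_eq_top {p : ℕ} [Fact p.Prime] {k : Type u} [Field k] [CharP k p]
    {G : Type u} [Group G] [Finite G] (B : Block k G) (R : Set (BrauerPair p B))
    (hR : ∀ P : BrauerPair p B, ∃ P', P' ∈ R ∧ P.IsGConj P') (n : ℕ) :
    ⨆ P ∈ R, (LinearMap.range (P.cohomIncl n).hom).map (transfer P.Q B.rep n).hom = ⊤ := by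
  set T := ⨆ P ∈ R, (LinearMap.range (P.cohomIncl n).hom).map (transfer P.Q B.rep n).hom with hT
  -- `N` consists of the maps that restrict to a `kΔG`-endomorphism of `B` with cohomological image
  -- in `T`. Right multiplication by `1_B` restricts to the identity, so its membership in `N`
  -- forces `T = ⊤`.
  let N : AddSubmonoid (MonoidAlgebra k G →ₗ[k] MonoidAlgebra k G) :=
    { carrier := {t | ∃ F : B.rep ⟶ B.rep,
        (∀ v : B.sub.toSubmodule, (F.hom v : B.sub.toSubmodule).1 = t v.1) ∧
        LinearMap.range (groupCohomology.map (A := B.rep) (B := B.rep) (MonoidHom.id G) F n).hom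
          ≤ T}
      zero_mem' := ⟨0, fun v => rfl, by
        rw [map_zero_id]
        rintro _ ⟨z, rfl⟩
        exact zero_mem T⟩
      add_mem' := by
        rintro s t ⟨F, hF, hF'⟩ ⟨F', hF1, hF2⟩
        refine ⟨F + F', fun v => ?_, ?_⟩
        · rw [LinearMap.add_apply, ← hF, ← hF1]
          rfl
        · rw [map_add_id]
          rintro _ ⟨z, rfl⟩
          exact add_mem (hF' ⟨z, rfl⟩) (hF2 ⟨z, rfl⟩) }
  have hmem : LinearMap.mulRight k B.idem ∈ N := by
    refine mulRight_idem_mem B N fun P φ hφ hφP => ?_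
    -- The trace for `P` is replaced by an equal trace for its conjugate in `R`.
    obtain ⟨P', hP', hconj⟩ := hR P
    obtain ⟨φ', h1, h2, h3⟩ := hconj.exists_relTrace_eq hφ hφP
    obtain ⟨F, hF, hF'⟩ := P'.exists_hom_of_relTrace h1 h2 n
    rw [← h3]
    exact ⟨F, hF, hF'.trans (le_iSup₂_of_le P' hP' le_rfl)⟩
  obtain ⟨F, hF, hF'⟩ := hmem
  have hid : F = 𝟙 B.rep := by
    ext v
    exact Subtype.ext ((hF v).trans (Block.mem_sub_iff.1 v.2))
  rw [hid, groupCohomology.map_id] at hF'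
  exact eq_top_iff.2 fun z _ => hF' ⟨z, rfl⟩

end Cohomology

end BlockCohomology

end

theorem mainTheorem2 {p : ℕ} [Fact p.Prime] {k : Type u} [Field k] [IsAlgClosed k] [CharP k p]
    {G : Type u} [Group G] [Finite G] (B : BlockCohomology.Block k G) :
    -- `B_{(Q,e)}` is a direct summand of `B` as a `k(C_G(Q) × C_G(Q))ΔQ`-module
    (∀ P : BlockCohomology.BrauerPair p B,
      ∃ C : Subrepresentation
          ((BlockCohomology.biRep k G).comp (BlockCohomology.centDiag P.Q).subtype),
        P.sub ⊓ C = ⊥ ∧ P.sub ⊔ C = B.resSub P.Q) ∧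
    -- `B_{(Q,e)}` is isomorphic to `kC_G(Q)e`
    (∀ P : BlockCohomology.BrauerPair p B,
      Nonempty (P.sub.toRepresentation.Equiv P.centBlockSub.toRepresentation)) ∧
    -- `H^*(ΔQ; B_{(Q,e)})` is a direct summand of `H^*(ΔQ; B)`
    (∀ (P : BlockCohomology.BrauerPair p B) (n : ℕ),
      ∃ r : groupCohomology (Rep.res P.Q.subtype B.rep) n →ₗ[k] groupCohomology P.rep n,
        r ∘ₗ (P.cohomIncl n).hom = LinearMap.id) ∧
    -- `H^*(ΔG; B)` is the sum of the transfers, over any set `R` of representatives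
    (∀ R : Set (BlockCohomology.BrauerPair p B),
      (∀ P : BlockCohomology.BrauerPair p B, ∃! P', P' ∈ R ∧ P.IsGConj P') →
      ∀ n : ℕ,
        ⨆ P ∈ R, (LinearMap.range (P.cohomIncl n).hom).map
          (BlockCohomology.transfer P.Q B.rep n).hom = ⊤) :=
  ⟨fun P => P.exists_isCompl, fun P => P.nonempty_equiv_centBlockSub,
    fun P n => P.exists_retraction_cohomIncl n,
    fun R hR n => BlockCohomology.iSup_map_transfer_eq_top B R (fun P => (hR P).exists) n⟩
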